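/- Conventions. The language $\lambda_M$ has one $k$-ary relation symbol $I_k$ for every integer $k\ge 1$, and first-order formulas may use equality. A matroid $M$ (finite, or infinite in the sense of Bruhn, Diestel, Kriesell, Pendavingh and Wollan) with ground set $E$ is viewed as a $\lambda_M$-structure on $E$ in which $I_k(x_1,\dots,x_k)$ holds if and only if $x_1,\dots,x_k$ are pairwise distinct and $\{x_1,\dots,x_k\}$ is independent in $M$. For a matroid $M$ with finite nonempty ground set $E$ and a first-order $\lambda_M$-formula $\varphi$ with $k\ge 0$ free variables, let $$\langle\varphi,M\rangle=\frac{\left|\{(x_1,\dots,x_k)\in E^k : M\models\varphi(x_1,\dots,x_k)\}\right|}{|E|^k}.$$ A sequence $(M_n)_{n\in\mathbb N}$ of such matroids is first-order convergent if $\langle\varphi,M_n\rangle$ converges as $n\to\infty$ for every first-order $\lambda_M$-formula $\varphi$. A $\lambda_M$-modeling is a $\lambda_M$-structure $\mathbf M$ whose domain is a standard Borel space equipped with a probability measure $\nu$ such that, for every $k\ge 0$ and every first-order formula $\varphi$ with $k$ free variables, the set $\mathbf M^\varphi$ of the $k$-tuples satisfying $\varphi$ is measurable with respect to the product measure $\nu^k$;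 put $\langle\varphi,\mathbf M\rangle=\nu^k(\mathbf M^\varphi)$. It is a limit modeling of $(M_n)_{n\in\mathbb N}$ if its structure is that of a (finite or infinite) matroid on its domain and $\langle\varphi,\mathbf M\rangle=\lim_{n\to\infty}\langle\varphi,M_n\rangle$ for every first-order $\lambda_M$-formula $\varphi$. A finite matroid is binary if it is representable over the two-element field $\mathbb F_2$. Theorem. There exists a first-order convergent sequence $(M_n)_{n\in\mathbb N}$ of finite binary matroids that has no limit modeling. -/

import Mathlib

universe u v

namespace FOMatroid

open MeasureTheory Filter Topology

/-- The relation symbols of the language of matroids: one `k`-ary symbol `I_k` for every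
positive integer `k`. -/
inductive IndepSymbol : ℕ → Type
  | indep (k : ℕ) : IndepSymbol (k + 1)

/-- The language of matroids. -/
def matroidLanguage : FirstOrder.Language.{0, 0} where
  Functions := fun _ => Empty
  Relations := IndepSymbol

/-- A tuple of elements is independent if its entries are pairwise distinct and form an
independent set. -/
def IndepTuple {α : Type u} (M : Matroid α) {k : ℕ} (x : Fin k → α) : Prop :=
  Function.Injective x ∧ M.Indep (Set.range x)

/-- The structure, in the language of matroids, on the ground set of a matroid: `I_k` holds for
the independent `k`-tuples. -/
@[reducible]
def groundStructure {α : Type u} (M : Matroid α) : matroidLanguage.Structure M.E where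
  funMap := fun f _ => nomatch f
  RelMap := fun r x =>
    match r, x with
    | .indep _, x => IndepTuple M (fun i => (x i : α))

/-- `M` is representable over the field `F`: the elements can be assigned vectors over `F` so that
independence in `M` is linear independence (as a family, so elements assigned equal vectors are
dependent). -/
def IsRepresentable (F : Type v) [Field F] {α : Type u} (M : Matroid α) : Prop :=
  ∃ (r : ℕ) (f : α → Fin r → F), ∀ I ⊆ M.E, M.Indep I ↔ LinearIndepOn F f I

/-- A binary matroid is a matroid representable over the two-element field. -/
def IsBinary {α : Type u} (M : Matroid α) : Prop :=
  IsRepresentable (ZMod 2) M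

/-- The Stone pairing of a first order formula with `k` free variables and a matroid with a finite
nonempty ground set `E` (carrying the uniform measure): the number of `k`-tuples satisfying the
formula divided by `|E| ^ k`. -/
noncomputable def finitePairing {α : Type u} (M : Matroid α) {k : ℕ}
    (φ : matroidLanguage.Formula (Fin k)) : ℝ :=
  letI := groundStructure M
  (Nat.card {x : Fin k → M.E // φ.Realize x} : ℝ) / (Nat.card M.E : ℝ) ^ k

/-- A sequence of matroids (with finite nonempty ground sets) is first order convergent if all its
Stone pairings converge. -/
def FOConvergent {α : Type u} (M : ℕ → Matroid α) : Prop :=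
  ∀ (k : ℕ) (φ : matroidLanguage.Formula (Fin k)),
    ∃ l : ℝ, Tendsto (fun n => finitePairing (M n) φ) atTop (𝓝 l)

/-- A modeling: a structure on a standard Borel space with a probability measure `ν` such that the
set of `k`-tuples satisfying a first order formula with `k` free variables is always measurable with
respect to the product measure `ν ^ k` (that is, it lies in the completed product
`σ`-algebra). -/
structure Modeling (L : FirstOrder.Language.{0, 0}) where
  carrier : Type u
  [str : L.Structure carrier]
  [mspace : MeasurableSpace carrier]
  [borel : StandardBorelSpace carrier]
  ν : Measure carrier
  [prob : IsProbabilityMeasure ν]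
  measurable_realize : ∀ (k : ℕ) (φ : L.Formula (Fin k)),
    NullMeasurableSet {x : Fin k → carrier | φ.Realize x} (Measure.pi fun _ => ν)

attribute [instance] Modeling.str Modeling.mspace Modeling.borel Modeling.prob

/-- The Stone pairing of a formula with `k` free variables and a modeling. -/
noncomputable def Modeling.pairing {L : FirstOrder.Language.{0, 0}} (A : Modeling.{u} L) {k : ℕ}
    (φ : L.Formula (Fin k)) : ℝ :=
  (Measure.pi fun _ : Fin k => A.ν).real {x : Fin k → A.carrier | φ.Realize x}

/-- The underlying structure of the modeling is a (finite or infinite) matroid: `I_k` consists of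
the independent `k`-tuples of some matroid on the whole domain. -/
def Modeling.IsMatroid (A : Modeling.{u} matroidLanguage) : Prop :=
  ∃ N : Matroid A.carrier, N.E = Set.univ ∧
    ∀ (k : ℕ) (x : Fin (k + 1) → A.carrier),
      FirstOrder.Language.Structure.RelMap (L := matroidLanguage) (IndepSymbol.indep k) x ↔
        IndepTuple N x

/-- A limit modeling of a sequence of finite matroids. -/
def IsLimitModeling {α : Type v} (A : Modeling.{u} matroidLanguage) (M : ℕ → Matroid α) : Prop :=
  A.IsMatroid ∧ ∀ (k : ℕ) (φ : matroidLanguage.Formula (Fin k)),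
    Tendsto (fun n => finitePairing (M n) φ) atTop (𝓝 (A.pairing φ))

end FOMatroid

/-! A sequence of quasirandom graphs of density 1/2 cannot converge to a measurable 0/1-valued
adjacency relation, and binary matroids can encode such graphs. On the vectors of `F₂ⁿ × F₂ⁿ` where
the quadratic form `a ⬝ᵥ b` equals 1, two points have their sum in the set exactly when their
symplectic product is 1. This graph is first-order definable in the linear matroid: adjacent points
lie in a dependent triple.

Character sums show that its signed 4-cycle density tends to 0 (`abs_sum_fourCycle_le`), so
`evenCycleFormula` has limiting pairing 1/2. In a modeling, adjacency is a measurable `±1` kernel up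
to null sets, and vanishing signed 4-cycle density would make it orthogonal to every rectangle,
which is impossible for such a kernel (`integral_fourCycle_ne_zero`). Compactness supplies a
convergent subsequence. -/

namespace FOMatroid

open MeasureTheory Filter Topology

/-! ### Signed 4-cycle densities of `±1` kernels. -/

/-- A kernel with values `±1` is not orthogonal to all measurable rectangles. -/
theorem exists_setIntegral_prod_ne_zero {Ω : Type*} [MeasurableSpace Ω] (ν : Measure Ω)
    [IsProbabilityMeasure ν] {H : Ω × Ω → ℝ} (hH : Measurable H)
    (hval : ∀ p, H p = 1 ∨ H p = -1) :
    ∃ U W : Set Ω, MeasurableSet U ∧ MeasurableSet W ∧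
      ∫ p in U ×ˢ W, H p ∂(ν.prod ν) ≠ 0 := by
  by_contra! hrect
  set S : Set (Ω × Ω) := H ⁻¹' {1} with hS
  have hSm : MeasurableSet S := hH (measurableSet_singleton 1)
  have hHS : ∀ p, H p = 2 * S.indicator 1 p - 1 := by
    intro p
    rcases hval p with h | h
    · have : p ∈ S := h
      simp [this, h]; norm_num
    · have : p ∉ S := by simp [hS, h]; norm_num
      simp [this, h]
  -- Orthogonality says that `S` fills exactly half of each rectangle, and rectangles determine the
  -- product measure. Evaluating this identity on `Sᶜ` and on `S` makes both null.
  have key : ν.prod ν = (2 : ENNReal) • (ν.prod ν).restrict S := by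
    refine Measure.prod_eq fun U W hU hW => ?_
    have hUW := hU.prod hW
    have h0 := hrect U W hU hW
    simp_rw [hHS] at h0
    have hint : Integrable (S.indicator (1 : Ω × Ω → ℝ)) ((ν.prod ν).restrict (U ×ˢ W)) :=
      (integrable_const (1 : ℝ)).indicator hSm
    rw [integral_sub (hint.const_mul 2) (integrable_const 1), integral_const_mul, integral_indicator_one hSm] at h0
    simp only [integral_const, smul_eq_mul, mul_one, Measure.real, Measure.restrict_apply hSm,
      Measure.restrict_apply MeasurableSet.univ, Set.univ_inter] at h0
    rw [← Measure.prod_prod, Measure.smul_apply, Measure.restrict_apply hUW, smul_eq_mul,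
      Set.inter_comm]
    rw [← ENNReal.toReal_eq_toReal_iff' (by finiteness) (by finiteness), ENNReal.toReal_mul]
    simp only [ENNReal.toReal_ofNat]
    linarith
  have hSc : (ν.prod ν) Sᶜ = 0 := by
    rw [key]
    simp [Measure.restrict_apply hSm.compl]
  have hS0 : (ν.prod ν).real S = 2 * (ν.prod ν).real S := by
    have : (ν.prod ν) S = 2 * (ν.prod ν) S := by
      conv_lhs => rw [key]
      simp
    rw [Measure.real]
    conv_lhs => rw [this]
    simp
  have h1 := probReal_add_probReal_compl (μ := ν.prod ν) hSm
  have h2 : (ν.prod ν).real Sᶜ = 0 := by simp [Measure.real, hSc]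
  linarith

/-- The density of 4-cycles, counted with signs, in a kernel with values `±1` is not zero. -/
theorem integral_fourCycle_ne_zero {Ω : Type*} [MeasurableSpace Ω] (ν : Measure Ω)
    [IsProbabilityMeasure ν] {H : Ω × Ω → ℝ} (hH : Measurable H)
    (hval : ∀ p, H p = 1 ∨ H p = -1) :
    ∫ w : (Ω × Ω) × (Ω × Ω), (H (w.1.1, w.2.1) * H (w.1.2, w.2.1)) *
      (H (w.1.1, w.2.2) * H (w.1.2, w.2.2)) ∂((ν.prod ν).prod (ν.prod ν)) ≠ 0 := by
  intro h0
  have habs : ∀ p, |H p| ≤ 1 := fun p => by rcases hval p with h | h <;> simp [h]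
  have bdd : ∀ {X : Type _} [MeasurableSpace X] (μ : Measure X) [IsProbabilityMeasure μ]
      {f : X → ℝ}, Measurable f → (∀ x, |f x| ≤ 1) → Integrable f μ := by
    intro X _ μ _ f hf hb
    exact Integrable.of_bound hf.aestronglyMeasurable 1 (.of_forall hb)
  have hmul : ∀ {a b : ℝ}, |a| ≤ 1 → |b| ≤ 1 → |a * b| ≤ 1 := by
    intro a b ha hb
    rw [abs_mul]
    exact mul_le_one₀ ha (abs_nonneg _) hb
  -- `g` is the signed codegree; by Fubini the 4-cycle integral is the integral of `g ^ 2`, so `g`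
  -- vanishes almost everywhere.
  set g : Ω × Ω → ℝ := fun p => ∫ z, H (p.1, z) * H (p.2, z) ∂ν with hg
  have hgm : Measurable g := by
    refine (StronglyMeasurable.integral_prod_right
      (f := fun (p : Ω × Ω) z => H (p.1, z) * H (p.2, z)) ?_).measurable
    exact Measurable.stronglyMeasurable (by fun_prop)
  have hgb : ∀ p, |g p| ≤ 1 := by
    intro p
    have := norm_integral_le_of_norm_le_const (μ := ν) (f := fun z => H (p.1, z) * H (p.2, z))
      (C := 1) (.of_forall fun z => hmul (habs _) (habs _))
    simpa using this
  have hg2 : ∫ p, g p * g p ∂(ν.prod ν) = 0 := by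
    rw [← h0, integral_prod (f := fun w : (Ω × Ω) × (Ω × Ω) =>
      (H (w.1.1, w.2.1) * H (w.1.2, w.2.1)) * (H (w.1.1, w.2.2) * H (w.1.2, w.2.2)))]
    · refine integral_congr_ae (.of_forall fun p => ?_)
      exact (integral_prod_mul (μ := ν) (ν := ν) (fun z => H (p.1, z) * H (p.2, z))
        (fun z => H (p.1, z) * H (p.2, z))).symm
    · exact bdd _ (by fun_prop) fun w => hmul (hmul (habs _) (habs _)) (hmul (habs _) (habs _))
  have hg0 : g =ᵐ[ν.prod ν] 0 := by
    rw [integral_eq_zero_iff_of_nonneg (fun p => mul_self_nonneg _)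
      (bdd _ (hgm.mul hgm) fun p => hmul (hgb p) (hgb p))] at hg2
    filter_upwards [hg2] with p hp
    simpa using hp
  obtain ⟨U, W, hU, hW, hne⟩ := exists_setIntegral_prod_ne_zero ν hH hval
  set u : Ω → Ω → ℝ := fun z x => U.indicator (fun x => H (x, z)) x with hu
  have hum : Measurable fun q : Ω × Ω => u q.1 q.2 := by
    have : (fun q : Ω × Ω => u q.1 q.2) =
        (Prod.snd ⁻¹' U).indicator fun q : Ω × Ω => H (q.2, q.1) := by
      ext q; rfl
    rw [this]
    exact Measurable.indicator (by fun_prop) (measurable_snd hU)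
  have hub : ∀ z x, |u z x| ≤ 1 := fun z x => by
    by_cases h : x ∈ U <;> simp [hu, h, habs]
  -- The integral of `c ^ 2` is the integral of `g` over `U ×ˢ U`, hence 0; and the integral of `H`
  -- over `U ×ˢ W` is that of `c` over `W`.
  set c : Ω → ℝ := fun z => ∫ x, u z x ∂ν with hc
  have hcm : Measurable c := (StronglyMeasurable.integral_prod_right
    (f := u) hum.stronglyMeasurable).measurable
  have hcb : ∀ z, |c z| ≤ 1 := by
    intro z
    have := norm_integral_le_of_norm_le_const (μ := ν) (f := u z)
      (C := 1) (.of_forall fun x => hub z x)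
    simpa using this
  have hc2 : ∫ z, c z * c z ∂ν = 0 := by
    have h1 : ∀ z, c z * c z = ∫ p : Ω × Ω, u z p.1 * u z p.2 ∂(ν.prod ν) := fun z =>
      (integral_prod_mul (μ := ν) (ν := ν) (u z) (u z)).symm
    simp_rw [h1]
    rw [integral_integral_swap (f := fun z (p : Ω × Ω) => u z p.1 * u z p.2)]
    · refine integral_eq_zero_of_ae ?_
      filter_upwards [hg0] with p hp
      by_cases h1 : p.1 ∈ U <;> by_cases h2 : p.2 ∈ U <;> simp [hu, h1, h2]
      simpa [hg] using hp
    · refine bdd _ ?_ fun q => hmul (hub _ _) (hub _ _)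
      exact (hum.comp (by fun_prop : Measurable fun q : Ω × (Ω × Ω) => (q.1, q.2.1))).mul
        (hum.comp (by fun_prop : Measurable fun q : Ω × (Ω × Ω) => (q.1, q.2.2)))
  have hc0 : c =ᵐ[ν] 0 := by
    rw [integral_eq_zero_iff_of_nonneg (fun p => mul_self_nonneg _)
      (bdd _ (hcm.mul hcm) fun p => hmul (hcb p) (hcb p))] at hc2
    filter_upwards [hc2] with p hp
    simpa using hp
  apply hne
  rw [← Measure.prod_restrict, integral_prod_symm]
  · refine integral_eq_zero_of_ae ?_
    filter_upwards [ae_restrict_of_ae hc0] with z hz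
    rw [← integral_indicator hU]
    exact hz
  · exact Integrable.of_bound hH.aestronglyMeasurable 1 (.of_forall habs)

/-! ### Character sums over the quadric. -/

/-- The nontrivial additive character of the two-element field. -/
noncomputable def sign2 (t : ZMod 2) : ℝ := if t = 0 then 1 else -1

theorem sign2_add (s t : ZMod 2) : sign2 (s + t) = sign2 s * sign2 t := by
  have h : ∀ r : ZMod 2, r = 0 ∨ r = 1 := by decide
  have h2 : (1 : ZMod 2) + 1 = 0 := by decide
  rcases h s with rfl | rfl <;> rcases h t with rfl | rfl <;> simp [sign2, h2]

theorem abs_sign2 (t : ZMod 2) : |sign2 t| = 1 := by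
  unfold sign2; split_ifs <;> simp

theorem sum_sign2_dotProduct {n : ℕ} (a : Fin n → ZMod 2) :
    ∑ b : Fin n → ZMod 2, sign2 (a ⬝ᵥ b) = if a = 0 then (2 : ℝ) ^ n else 0 := by
  split_ifs with h
  · subst h
    simp [sign2]
  · obtain ⟨i, hi⟩ : ∃ i, a i ≠ 0 := by
      by_contra! hcon
      exact h (funext hcon)
    have hi1 : sign2 (a ⬝ᵥ Pi.single i 1) = -1 := by simp [sign2, hi]
    -- Translation by the `i`-th unit vector flips every sign, so the sum equals its own negative.
    have hsum := Equiv.sum_comp (Equiv.addRight (Pi.single i (1 : ZMod 2)))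
      (fun b : Fin n → ZMod 2 => sign2 (a ⬝ᵥ b))
    simp only [Equiv.coe_addRight, dotProduct_add, sign2_add, hi1, mul_neg, mul_one,
      Finset.sum_neg_distrib] at hsum
    linarith

/-- The standard symplectic form on `F₂ⁿ × F₂ⁿ`. -/
def symplectic {n : ℕ} (u z : (Fin n → ZMod 2) × (Fin n → ZMod 2)) : ZMod 2 :=
  u.1 ⬝ᵥ z.2 + u.2 ⬝ᵥ z.1

theorem symplectic_add_left {n : ℕ} (u v z : (Fin n → ZMod 2) × (Fin n → ZMod 2)) :
    symplectic (u + v) z = symplectic u z + symplectic v z := by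
  simp only [symplectic, Prod.fst_add, Prod.snd_add, add_dotProduct]
  ring

theorem symplectic_self {n : ℕ} (u : (Fin n → ZMod 2) × (Fin n → ZMod 2)) :
    symplectic u u = 0 := by
  rw [symplectic, dotProduct_comm u.2, CharTwo.add_self_eq_zero]

/-- Summing over the second coordinate kills every `a` except `a = u.1`, leaving one term of modulus
`2 ^ n`, the square root of the number of points. -/
theorem sum_sign2_quadratic_add_symplectic {n : ℕ}
    (u : (Fin n → ZMod 2) × (Fin n → ZMod 2)) :
    ∑ z : (Fin n → ZMod 2) × (Fin n → ZMod 2), sign2 (z.1 ⬝ᵥ z.2 + symplectic u z) =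
      sign2 (u.2 ⬝ᵥ u.1) * 2 ^ n := by
  rw [Fintype.sum_prod_type]
  have h : ∀ a b : Fin n → ZMod 2, sign2 (a ⬝ᵥ b + symplectic u (a, b)) =
      sign2 (u.2 ⬝ᵥ a) * sign2 ((a + u.1) ⬝ᵥ b) := by
    intro a b
    rw [← sign2_add, symplectic, add_dotProduct]
    congr 1
    ring
  simp_rw [h, ← Finset.mul_sum, sum_sign2_dotProduct]
  have h2 : ∀ a : Fin n → ZMod 2, a + u.1 = 0 ↔ a = u.1 := fun a => by
    rw [add_eq_zero_iff_eq_neg, ZModModule.neg_eq_self]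
  simp [h2]

theorem sum_sign2_symplectic {n : ℕ} {u : (Fin n → ZMod 2) × (Fin n → ZMod 2)} (hu : u ≠ 0) :
    ∑ z : (Fin n → ZMod 2) × (Fin n → ZMod 2), sign2 (symplectic u z) = 0 := by
  simp only [symplectic, sign2_add, Fintype.sum_prod_type, ← Finset.sum_mul,
    ← Finset.mul_sum, sum_sign2_dotProduct]
  have : u.1 ≠ 0 ∨ u.2 ≠ 0 := by
    by_contra! h
    exact hu (Prod.ext h.1 h.2)
  rcases this with h | h <;> simp [h]

/-- The solutions `(a, b)` of the quadratic equation `a ⬝ᵥ b = 1` in `F₂ⁿ × F₂ⁿ`. -/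
abbrev Quadric (n : ℕ) : Type :=
  {p : (Fin n → ZMod 2) × (Fin n → ZMod 2) // p.1 ⬝ᵥ p.2 = 1}

/-- The indicator of the value 1 is `(1 - sign2) / 2`. -/
theorem sum_quadric {n : ℕ} (f : (Fin n → ZMod 2) × (Fin n → ZMod 2) → ℝ) :
    ∑ z : Quadric n, f z = (∑ z, f z - ∑ z, sign2 (z.1 ⬝ᵥ z.2) * f z) / 2 := by
  have h : ∀ z : (Fin n → ZMod 2) × (Fin n → ZMod 2),
      (if z.1 ⬝ᵥ z.2 = 1 then f z else 0) = (f z - sign2 (z.1 ⬝ᵥ z.2) * f z) / 2 := by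
    intro z
    have h01 : ∀ r : ZMod 2, r = 0 ∨ r = 1 := by decide
    rcases h01 (z.1 ⬝ᵥ z.2) with h | h <;> simp [h, sign2]
  rw [← Finset.sum_subtype (Finset.univ.filter fun z => z.1 ⬝ᵥ z.2 = 1) (by simp) f,
    Finset.sum_filter, ← Finset.sum_sub_distrib, Finset.sum_div]
  exact Finset.sum_congr rfl fun z _ => h z

theorem card_quadric (n : ℕ) :
    (Fintype.card (Quadric n) : ℝ) = ((2 : ℝ) ^ n * 2 ^ n - 2 ^ n) / 2 := by
  have h1 := sum_quadric (n := n) fun _ => 1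
  have h2 := sum_sign2_quadratic_add_symplectic (n := n) 0
  simp [symplectic] at h1 h2
  rw [h1, h2]
  simp [sign2]

/-- The shift to `n + 1` avoids the empty `Quadric 0`; the cardinality is `2 * 4 ^ n - 2 ^ n`. -/
theorem le_card_quadric (n : ℕ) :
    (4 : ℝ) ^ n ≤ Fintype.card (Quadric (n + 1)) := by
  rw [card_quadric]
  have h4 : (4 : ℝ) ^ n = 2 ^ n * 2 ^ n := by rw [← mul_pow]; norm_num
  have : (1 : ℝ) ≤ 2 ^ n := one_le_pow₀ (by norm_num)
  rw [h4, pow_succ]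
  nlinarith

theorem abs_sum_quadric_sign2_symplectic_le {n : ℕ}
    {u : (Fin n → ZMod 2) × (Fin n → ZMod 2)} (hu : u ≠ 0) :
    |∑ z : Quadric n, sign2 (symplectic u z)| ≤ 2 ^ n := by
  rw [sum_quadric fun z => sign2 (symplectic u z), sum_sign2_symplectic hu]
  simp_rw [← sign2_add]
  rw [sum_sign2_quadratic_add_symplectic, zero_sub, abs_div, abs_neg, abs_mul, abs_sign2, one_mul,
    abs_of_pos (by positivity : (0 : ℝ) < 2 ^ n), abs_two]
  have : (0 : ℝ) < 2 ^ n := by positivity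
  linarith

/-- For fixed `x`, `y` the sum over the other two vertices is the square of the character sum at `x
+ y`. It is at most `N ^ 2` on the diagonal and `(2 ^ n) ^ 2` off it. -/
theorem abs_sum_fourCycle_le (n : ℕ) :
    |∑ w : (Quadric n × Quadric n) × (Quadric n × Quadric n),
      (sign2 (symplectic w.1.1.1 w.2.1.1) * sign2 (symplectic w.1.2.1 w.2.1.1)) *
      (sign2 (symplectic w.1.1.1 w.2.2.1) * sign2 (symplectic w.1.2.1 w.2.2.1))| ≤
    (Fintype.card (Quadric n) : ℝ) ^ 3 + (Fintype.card (Quadric n) : ℝ) ^ 2 * 4 ^ n := by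
  set N : ℝ := (Fintype.card (Quadric n) : ℝ) with hN
  have hterm : ∀ x y : Quadric n,
      |∑ q : Quadric n × Quadric n,
        (sign2 (symplectic x.1 q.1.1) * sign2 (symplectic y.1 q.1.1)) *
        (sign2 (symplectic x.1 q.2.1) * sign2 (symplectic y.1 q.2.1))| ≤
      (if x = y then N ^ 2 else 0) + 4 ^ n := by
    intro x y
    simp_rw [← sign2_add _ (symplectic _ _), ← symplectic_add_left, Fintype.sum_prod_type,
      ← Finset.mul_sum, ← Finset.sum_mul]
    rw [← sq, abs_of_nonneg (sq_nonneg _), ← sq_abs]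
    split_ifs with h
    · have : |∑ z : Quadric n, sign2 (symplectic (x.1 + y.1) z.1)| ≤ N := by
        refine (Finset.abs_sum_le_sum_abs _ _).trans ?_
        simp [abs_sign2, hN]
      have h4 : (0 : ℝ) ≤ 4 ^ n := by positivity
      nlinarith [abs_nonneg (∑ z : Quadric n, sign2 (symplectic (x.1 + y.1) z.1))]
    · have hne : x.1 + y.1 ≠ 0 := fun h0 => h <| Subtype.ext <| by
        rwa [add_eq_zero_iff_eq_neg, ZModModule.neg_eq_self] at h0
      have h1 := abs_sum_quadric_sign2_symplectic_le hne
      have h4 : (4 : ℝ) ^ n = (2 ^ n) ^ 2 := by rw [← pow_mul, mul_comm, pow_mul]; norm_num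
      rw [zero_add, h4]
      gcongr
  rw [Fintype.sum_prod_type, Fintype.sum_prod_type]
  calc _ ≤ ∑ x : Quadric n, ∑ y : Quadric n, ((if x = y then N ^ 2 else 0) + 4 ^ n) :=
        (Finset.abs_sum_le_sum_abs _ _).trans <| Finset.sum_le_sum fun x _ =>
          (Finset.abs_sum_le_sum_abs _ _).trans <| Finset.sum_le_sum fun y _ => hterm x y
    _ = _ := by
        simp [Finset.sum_add_distrib, ← hN]
        ring

/-! ### Linear matroids of finite families of vectors. -/

section LinearMatroid

variable {F V α : Type*} [Field F] [AddCommGroup V] [Module F V]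

/-- If no element could be added, the vectors of `J` would lie in the span of those of `I`, against
the Steinitz bound. -/
theorem exists_linearIndepOn_insert {f : α → V} {I J : Set α} (hI : LinearIndepOn F f I)
    (hIfin : I.Finite) (hJ : LinearIndepOn F f J) (hJfin : J.Finite) (hcard : I.ncard < J.ncard) :
    ∃ e ∈ J, e ∉ I ∧ LinearIndepOn F f (insert e I) := by
  by_contra! hcon
  have hspan : ∀ e ∈ J, f e ∈ Submodule.span F (f '' I) := by
    intro e he
    by_cases heI : e ∈ I
    · exact Submodule.subset_span ⟨e, heI, rfl⟩
    · by_contra hnot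
      exact hcon e he heI ((linearIndepOn_insert heI).2 ⟨hI, hnot⟩)
  have := hJfin.fintype
  have := (hIfin.image f).fintype
  have hle := linearIndependent_le_span_aux' (R := F) (fun x : J => f x) hJ (f '' I)
    (by rintro _ ⟨x, rfl⟩; exact hspan x x.2)
  rw [← Nat.card_eq_fintype_card, ← Nat.card_eq_fintype_card, Nat.card_coe_set_eq,
    Nat.card_coe_set_eq] at hle
  have := Set.ncard_image_le (f := f) hIfin
  omega

variable (F) in
/-- The linear matroid of a family of vectors indexed by a finite set. -/
def linearMatroid {E : Set α} (hE : E.Finite) (f : α → V) : Matroid α :=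
  (IndepMatroid.ofFinite hE (fun I => I ⊆ E ∧ LinearIndepOn F f I)
    ⟨Set.empty_subset _, linearIndepOn_empty F f⟩
    (fun _ _ hJ hIJ => ⟨hIJ.trans hJ.1, hJ.2.mono hIJ⟩)
    (fun _ _ hI hJ hIJ => by
      obtain ⟨e, heJ, heI, h⟩ := exists_linearIndepOn_insert hI.2 (hE.subset hI.1) hJ.2
        (hE.subset hJ.1) hIJ
      exact ⟨e, heJ, heI, Set.insert_subset (hJ.1 heJ) hI.1, h⟩)
    (fun _ hI => hI.1)).matroid

theorem linearMatroid_indep_iff {E : Set α} (hE : E.Finite) (f : α → V) (I : Set α) :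
    (linearMatroid F hE f).Indep I ↔ I ⊆ E ∧ LinearIndepOn F f I := by
  simp [linearMatroid, IndepMatroid.ofFinite, IndepMatroid.ofBddAugment, IndepMatroid.ofBdd]

theorem indepTuple_linearMatroid_iff {E : Set α} (hE : E.Finite) (f : α → V) {k : ℕ}
    (x : Fin k → E) : IndepTuple (linearMatroid F hE f) (fun i => (x i : α)) ↔
      LinearIndependent F fun i => f (x i) := by
  rw [IndepTuple, linearMatroid_indep_iff]
  constructor
  · rintro ⟨hinj, -, h⟩
    exact (linearIndepOn_range_iff hinj f).1 h
  · intro h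
    have hinj : Function.Injective fun i => (x i : α) := fun i j hij =>
      h.injective (congrArg f hij)
    exact ⟨hinj, by rintro _ ⟨i, rfl⟩; exact (x i).2, (linearIndepOn_range_iff hinj f).2 h⟩

variable (F) in
theorem exists_representable_matroid [FiniteDimensional F V] {ι : Type*} [Finite ι] (f : ι → V) :
    ∃ (M : Matroid ℕ) (e : M.E ≃ ι), IsRepresentable F M ∧
      ∀ (k : ℕ) (x : Fin k → M.E), IndepTuple M (fun i => (x i : ℕ)) ↔
        LinearIndependent F fun i => f (e (x i)) := by
  obtain ⟨N, ⟨e⟩⟩ := Finite.exists_equiv_fin ι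
  obtain ⟨e'⟩ : Nonempty (Set.Iio N ≃ ι) := ⟨(Fin.equivSubtype (n := N)).symm.trans e.symm⟩
  obtain ⟨r, φ, hφ⟩ : ∃ (r : ℕ) (φ : V →ₗ[F] Fin r → F), LinearMap.ker φ = ⊥ :=
    ⟨_, (Module.finBasis F V).equivFun.toLinearMap, (Module.finBasis F V).equivFun.ker⟩
  -- The value 0 outside the ground set is arbitrary: representability only tests subsets of the
  -- ground set.
  obtain ⟨g, hg⟩ : ∃ g : ℕ → Fin r → F, ∀ k : Set.Iio N, g k = φ (f (e' k)) := by
    refine ⟨fun k => if h : k < N then φ (f (e' ⟨k, h⟩)) else 0, fun k => ?_⟩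
    exact dif_pos k.2
  refine ⟨linearMatroid F (Set.finite_Iio N) g, e', ⟨_, g, fun I hI => ?_⟩, fun k x => ?_⟩
  · exact (linearMatroid_indep_iff _ _ _).trans (and_iff_right hI)
  · refine (indepTuple_linearMatroid_iff (Set.finite_Iio N) g x).trans ?_
    have hgx : (fun i => g (x i)) = φ ∘ fun i => f (e' (x i)) :=
      funext fun i => hg (x i)
    rw [hgx]
    exact φ.linearIndependent_iff hφ

end LinearMatroid

/-- Over `F₂` a relation is a vanishing subsum; nonzero, distinct vectors leave only the full sum.
-/
theorem linearIndependent_zmod_two_triple {V : Type*} [AddCommGroup V] [Module (ZMod 2) V]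
    {a b c : V} (ha : a ≠ 0) (hb : b ≠ 0) (hc : c ≠ 0) (hab : a ≠ b) (hac : a ≠ c) (hbc : b ≠ c) :
    LinearIndependent (ZMod 2) ![a, b, c] ↔ a + b + c ≠ 0 := by
  have hsum : ∀ x y : V, x + y = 0 ↔ x = y := fun x y => by
    rw [add_eq_zero_iff_eq_neg, ZModModule.neg_eq_self]
  rw [Fintype.linearIndependent_iff]
  constructor
  · intro h h0
    simpa using h (fun _ => 1) (by simpa [Fin.sum_univ_three] using h0) 0
  · intro h g hg
    have h01 : ∀ r : ZMod 2, r = 0 ∨ r = 1 := by decide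
    rw [Fin.sum_univ_three] at hg
    rcases h01 (g 0) with h0 | h0 <;> rcases h01 (g 1) with h1 | h1 <;>
      rcases h01 (g 2) with h2 | h2 <;> simp [h0, h1, h2, ha, hb, hc, hsum, hab, hac, hbc] at hg
    · intro i
      fin_cases i <;> assumption
    · exact absurd ((hsum _ _).2 hg) h

/-! ### The adjacency and even-cycle formulas. -/

section Formulas

open FirstOrder FirstOrder.Language

/-- `x` and `y` are distinct, and together with a third element they form a triple outside the
relation `R`. -/
def lineFormula {L : Language} (R : L.Relations 3) : L.Formula (Fin 2) :=
  letI x : L.Term (Fin 2 ⊕ Fin 1) := Term.var (Sum.inl 0)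
  letI y : L.Term (Fin 2 ⊕ Fin 1) := Term.var (Sum.inl 1)
  letI z : L.Term (Fin 2 ⊕ Fin 1) := Term.var (Sum.inr 0)
  ((x.bdEqual y).not ⊓ (x.bdEqual z).not ⊓ (y.bdEqual z).not ⊓
    (R.boundedFormula ![x, y, z]).not).ex

theorem realize_lineFormula {L : Language} (R : L.Relations 3) {A : Type*} [L.Structure A]
    (v : Fin 2 → A) :
    (lineFormula R).Realize v ↔ ∃ z, v 0 ≠ v 1 ∧ v 0 ≠ z ∧ v 1 ≠ z ∧
      ¬ Structure.RelMap R ![v 0, v 1, z] := by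
  simp only [lineFormula, Formula.Realize, BoundedFormula.realize_ex, BoundedFormula.realize_inf,
    BoundedFormula.realize_not, BoundedFormula.realize_bdEqual, BoundedFormula.realize_rel,
    Term.realize_var, Sum.elim_inl, Sum.elim_inr, and_assoc]
  refine exists_congr fun z => ?_
  have h1 : Fin.snoc (α := fun _ => A) (default : Fin 0 → A) z 0 = z := by
    simp [Fin.snoc]
  rw [h1]
  have h2 : (fun i => Term.realize (Sum.elim v (Fin.snoc (α := fun _ => A) (default : Fin 0 → A) z))
      ((![Term.var (Sum.inl 0), Term.var (Sum.inl 1), Term.var (Sum.inr 0)] :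
        Fin 3 → L.Term (Fin 2 ⊕ Fin 1)) i)) = ![v 0, v 1, z] := by
    funext i
    fin_cases i <;> simp [h1]
  rw [h2]

/-- `x` and `y` are distinct and form a dependent triple with a third element. -/
def adjFormula : matroidLanguage.Formula (Fin 2) :=
  lineFormula (L := matroidLanguage) (IndepSymbol.indep 2)

/-- The number of edges of the 4-cycle `x₀ x₂ x₁ x₃` is even. -/
def evenCycleFormula : matroidLanguage.Formula (Fin 4) :=
  ((adjFormula.relabel ![0, 2]).iff (adjFormula.relabel ![1, 2])).iff
    ((adjFormula.relabel ![0, 3]).iff (adjFormula.relabel ![1, 3]))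

open Classical in
/-- The `±1`-valued kernel of the adjacency relation. -/
noncomputable def adjSign {A : Type*} [matroidLanguage.Structure A] (p : A × A) : ℝ :=
  if adjFormula.Realize ![p.1, p.2] then 1 else -1

open Classical in
theorem adjSign_fourCycle {A : Type*} [matroidLanguage.Structure A] (x : Fin 4 → A) :
    (adjSign (x 0, x 2) * adjSign (x 1, x 2)) * (adjSign (x 0, x 3) * adjSign (x 1, x 3)) =
      if evenCycleFormula.Realize x then 1 else -1 := by
  have h : ∀ i j, x ∘ ![i, j] = ![x i, x j] := fun i j => by
    funext k; fin_cases k <;> rfl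
  simp only [evenCycleFormula, Formula.realize_iff, Formula.realize_relabel, h, adjSign]
  by_cases h1 : adjFormula.Realize ![x 0, x 2] <;> by_cases h2 : adjFormula.Realize ![x 1, x 2] <;>
  by_cases h3 : adjFormula.Realize ![x 0, x 3] <;> by_cases h4 : adjFormula.Realize ![x 1, x 3] <;>
    simp [h1, h2, h3, h4]

/-- Makes the formulas countable, so that the product of unit intervals indexed by them is first
countable and its compactness is sequential. -/
instance : Countable matroidLanguage.Symbols := by
  have h1 : ∀ l, Countable (matroidLanguage.Functions l) := fun l =>
    inferInstanceAs (Countable Empty)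
  have h2 : ∀ l, Countable (matroidLanguage.Relations l) := fun l => by
    have : Subsingleton (IndepSymbol l) := ⟨fun a b => by cases a; cases b; rfl⟩
    exact inferInstanceAs (Countable (IndepSymbol l))
  unfold Language.Symbols
  infer_instance

end Formulas

/-! ### Compactness of Stone pairings. -/

/-- Every sequence of matroids has a first order convergent subsequence. -/
theorem exists_strictMono_foConvergent {α : Type*} (M : ℕ → Matroid α)
    (hfin : ∀ n, (M n).E.Finite) : ∃ s : ℕ → ℕ, StrictMono s ∧ FOConvergent (M ∘ s) := by
  let P : ℕ → (Σ k, matroidLanguage.Formula (Fin k)) → ℝ := fun n φ => finitePairing (M n) φ.2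
  have hP : ∀ n, P n ∈ Set.univ.pi fun _ => Set.Icc (0 : ℝ) 1 := by
    intro n φ _
    have := (hfin n).to_subtype
    refine ⟨by unfold P finitePairing; positivity, div_le_one_of_le₀ ?_ (by positivity)⟩
    have h := Finite.card_subtype_le
      (fun x : Fin φ.1 → (M n).E => letI := groundStructure (M n); φ.2.Realize x)
    rw [Nat.card_fun, Nat.card_fin] at h
    exact_mod_cast h
  obtain ⟨l, -, s, hs, hl⟩ :=
    (isCompact_univ_pi fun _ => isCompact_Icc).tendsto_subseq hP
  exact ⟨s, hs, fun k φ => ⟨l ⟨k, φ⟩, (tendsto_pi_nhds.1 hl) ⟨k, φ⟩⟩⟩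

/-! ### The graph defined in a quadric matroid. -/

section Quadric

theorem quadric_ne_zero {n : ℕ} (a : Quadric n) : a.1 ≠ 0 := by
  intro h
  have := a.2
  rw [h] at this
  simp at this

/-- The polar form of `a ⬝ᵥ b` is `symplectic`, and the two values 1 cancel in characteristic 2. -/
theorem add_mem_quadric_iff {n : ℕ} (a b : Quadric n) :
    (a.1 + b.1).1 ⬝ᵥ (a.1 + b.1).2 = 1 ↔ symplectic a.1 b.1 = 1 := by
  have h : (a.1 + b.1).1 ⬝ᵥ (a.1 + b.1).2 = symplectic a.1 b.1 := by
    simp only [Prod.fst_add, Prod.snd_add, add_dotProduct, dotProduct_add, a.2, b.2, symplectic,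
      dotProduct_comm b.1.1 a.1.2]
    have h2 : (1 : ZMod 2) + 1 = 0 := by decide
    linear_combination h2
  rw [h]

/-- `e` identifies the ground set of `M` with a quadric, and independence in `M` with linear
independence. -/
def IsQuadricCoord {n : ℕ} {M : Matroid ℕ} (e : M.E ≃ Quadric n) : Prop :=
  ∀ (k : ℕ) (x : Fin k → M.E), IndepTuple M (fun i => (x i : ℕ)) ↔
    LinearIndependent (ZMod 2) fun i => (e (x i)).1

variable {n : ℕ} {M : Matroid ℕ} {e : M.E ≃ Quadric n}

/-- The third point of a dependent triple must be the sum of the other two, so its existence means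
that this sum lies on the quadric. -/
theorem realize_adjFormula_iff_symplectic (h : IsQuadricCoord e) (x y : M.E) :
    letI := groundStructure M
    adjFormula.Realize ![x, y] ↔ symplectic (e x).1 (e y).1 = 1 := by
  let := groundStructure M
  have hne : ∀ {x y : M.E}, x ≠ y → (e x).1 ≠ (e y).1 := fun hxy h0 =>
    hxy (e.injective (Subtype.ext h0))
  have hrel : ∀ z : M.E, x ≠ y → x ≠ z → y ≠ z →
      (¬ FirstOrder.Language.Structure.RelMap (L := matroidLanguage) (IndepSymbol.indep 2)
        ![x, y, z] ↔ (e x).1 + (e y).1 = (e z).1) := by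
    intro z hxy hxz hyz
    have h1 : FirstOrder.Language.Structure.RelMap (L := matroidLanguage) (IndepSymbol.indep 2)
        ![x, y, z] ↔ IndepTuple M (fun i => (![x, y, z] i : ℕ)) := Iff.rfl
    have h2 : (fun i => (e (![x, y, z] i)).1) = ![(e x).1, (e y).1, (e z).1] := by
      funext i; fin_cases i <;> rfl
    rw [h1, h, h2, linearIndependent_zmod_two_triple (quadric_ne_zero _) (quadric_ne_zero _)
      (quadric_ne_zero _) (hne hxy) (hne hxz) (hne hyz), not_not, add_eq_zero_iff_eq_neg,
      ZModModule.neg_eq_self]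
  refine (realize_lineFormula (L := matroidLanguage) _ _).trans ?_
  constructor
  · rintro ⟨z, hxy, hxz, hyz, hz⟩
    rw [← add_mem_quadric_iff, (hrel z hxy hxz hyz).1 hz]
    exact (e z).2
  · intro hs
    have hxy : x ≠ y := by
      rintro rfl
      rw [symplectic_self] at hs
      exact zero_ne_one hs
    obtain ⟨z, hz⟩ := e.surjective ⟨(e x).1 + (e y).1, (add_mem_quadric_iff _ _).2 hs⟩
    have hz' : (e x).1 + (e y).1 = (e z).1 := by rw [hz]
    have hxz : x ≠ z := by
      rintro rfl
      exact quadric_ne_zero (e y) (by simpa using hz')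
    have hyz : y ≠ z := by
      rintro rfl
      exact quadric_ne_zero (e x) (by simpa using hz')
    exact ⟨z, hxy, hxz, hyz, (hrel z hxy hxz hyz).2 hz'⟩

theorem adjSign_eq_neg_sign2 (h : IsQuadricCoord e) (p : M.E × M.E) :
    letI := groundStructure M
    adjSign p = - sign2 (symplectic (e p.1).1 (e p.2).1) := by
  have h01 : ∀ r : ZMod 2, r = 0 ∨ r = 1 := by decide
  simp only [adjSign, realize_adjFormula_iff_symplectic h, sign2]
  rcases h01 (symplectic (e p.1).1 (e p.2).1) with h | h <;> simp [h]

theorem abs_two_mul_finitePairing_sub_one_le [Finite M.E] [Nonempty M.E]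
    (h : IsQuadricCoord e) :
    |2 * finitePairing M evenCycleFormula - 1| ≤
      ((Fintype.card (Quadric n) : ℝ) ^ 3 + (Fintype.card (Quadric n) : ℝ) ^ 2 * 4 ^ n) /
        (Fintype.card (Quadric n) : ℝ) ^ 4 := by
  classical
  let := groundStructure M
  let := Fintype.ofFinite M.E
  have hcard : Nat.card M.E = Fintype.card (Quadric n) := by
    rw [Nat.card_congr e, Nat.card_eq_fintype_card]
  have hpos : (0 : ℝ) < Fintype.card (Quadric n) := by
    rw [← hcard]
    exact_mod_cast Nat.card_pos
  let r : (Fin 4 → M.E) ≃ (Quadric n × Quadric n) × (Quadric n × Quadric n) :=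
    { toFun := fun x => ((e (x 0), e (x 1)), (e (x 2), e (x 3)))
      invFun := fun w => ![e.symm w.1.1, e.symm w.1.2, e.symm w.2.1, e.symm w.2.2]
      left_inv := fun x => by funext i; fin_cases i <;> simp
      right_inv := fun w => by simp }
  have hsum := abs_sum_fourCycle_le n
  rw [← Equiv.sum_comp r] at hsum
  have hterm : ∀ x : Fin 4 → M.E,
      (sign2 (symplectic (r x).1.1.1 (r x).2.1.1) * sign2 (symplectic (r x).1.2.1 (r x).2.1.1)) *
      (sign2 (symplectic (r x).1.1.1 (r x).2.2.1) * sign2 (symplectic (r x).1.2.1 (r x).2.2.1)) =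
      if evenCycleFormula.Realize x then 1 else -1 := by
    intro x
    -- Each `adjSign` is minus a `sign2`; the four minus signs cancel.
    rw [← adjSign_fourCycle]
    simp only [adjSign_eq_neg_sign2 h, r, Equiv.coe_fn_mk]
    ring
  have hval : ∑ x : Fin 4 → M.E, (if evenCycleFormula.Realize x then (1 : ℝ) else -1) =
      2 * (Nat.card {x : Fin 4 → M.E // evenCycleFormula.Realize x} : ℝ) -
        (Fintype.card (Quadric n) : ℝ) ^ 4 := by
    have h1 : ∀ x : Fin 4 → M.E, (if evenCycleFormula.Realize x then (1 : ℝ) else -1) =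
        2 * (if evenCycleFormula.Realize x then 1 else 0) - 1 := by
      intro x; split_ifs <;> norm_num
    have h2 : (Fintype.card (Fin 4 → M.E) : ℝ) = (Fintype.card (Quadric n) : ℝ) ^ 4 := by
      rw [Fintype.card_fun, Fintype.card_fin, ← hcard, Nat.card_eq_fintype_card]
      push_cast; rfl
    simp_rw [h1]
    rw [Finset.sum_sub_distrib, ← Finset.mul_sum, Finset.sum_boole, Nat.card_eq_fintype_card,
      Fintype.card_subtype]
    simp [← h2]
  simp_rw [hterm] at hsum
  rw [hval] at hsum
  have hfp : 2 * finitePairing M evenCycleFormula - 1 =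
      (2 * (Nat.card {x : Fin 4 → M.E // evenCycleFormula.Realize x} : ℝ) -
        (Fintype.card (Quadric n) : ℝ) ^ 4) / (Fintype.card (Quadric n) : ℝ) ^ 4 := by
    rw [finitePairing, hcard]
    field_simp
  rw [hfp, abs_div, abs_of_pos (pow_pos hpos 4)]
  gcongr

end Quadric

/-- With `N ≥ 4 ^ n` points, the diagonal contributes `1 / N ≤ 4 ^ (-n)` and the rest `4 ^ (n + 1) /
N ^ 2 ≤ 4 * 4 ^ (-n)`, whence the constant 5. -/
theorem exists_quadric_matroid (n : ℕ) : ∃ M : Matroid ℕ,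
    (M.E.Finite ∧ M.E.Nonempty ∧ IsBinary M) ∧
      |2 * finitePairing M evenCycleFormula - 1| ≤ 5 * (1 / 4 : ℝ) ^ n := by
  obtain ⟨M, e, hrep, h⟩ := exists_representable_matroid (ZMod 2)
    (fun p : Quadric (n + 1) => p.1)
  have hN := le_card_quadric n
  have h4 : (0 : ℝ) < 4 ^ n := by positivity
  have hfin : Finite M.E := Finite.of_equiv _ e.symm
  have : Nonempty (Quadric (n + 1)) := by
    rw [← Fintype.card_pos_iff]
    exact_mod_cast h4.trans_le hN
  have hne : Nonempty M.E := e.symm.nonempty_congr.1 this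
  refine ⟨M, ⟨hfin, Set.nonempty_coe_sort.1 hne, hrep⟩,
    (abs_two_mul_finitePairing_sub_one_le h).trans ?_⟩
  set N : ℝ := (Fintype.card (Quadric (n + 1)) : ℝ)
  have hNpos : 0 < N := h4.trans_le hN
  rw [div_le_iff₀ (by positivity), one_div, inv_pow, pow_succ (4 : ℝ), mul_assoc, ← div_eq_inv_mul,
    mul_div_assoc', le_div_iff₀ h4]
  have h1 : N ^ 3 * 4 ^ n ≤ N ^ 3 * N := by gcongr
  have h2 : (4 : ℝ) ^ n * 4 ^ n ≤ N * N := by gcongr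
  have h3 : N ^ 2 * ((4 : ℝ) ^ n * 4 ^ n) ≤ N ^ 2 * (N * N) := by gcongr
  nlinarith

/-! ### Even 4-cycles in modelings. -/

section Modeling

variable {Ω : Type*} [MeasurableSpace Ω] (ν : Measure Ω) [IsProbabilityMeasure ν]

theorem measurePreserving_pi_pair {k : ℕ} {i j : Fin k} (hij : i ≠ j) :
    MeasurePreserving (fun x : Fin k → Ω => (x i, x j)) (Measure.pi fun _ => ν) (ν.prod ν) := by
  refine ⟨by fun_prop, ?_⟩
  have hind := ProbabilityTheory.iIndepFun_pi (μ := fun _ : Fin k => ν) (X := fun _ => id)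
    (fun _ => aemeasurable_id)
  have h := (hind.indepFun hij).map_prod_eq_prod_map_map
    (measurable_pi_apply i).aemeasurable (measurable_pi_apply j).aemeasurable
  rw [h, (measurePreserving_eval (fun _ => ν) i).map_eq,
    (measurePreserving_eval (fun _ => ν) j).map_eq]

theorem measurePreserving_pi_pair_pair :
    MeasurePreserving (fun x : Fin 4 → Ω => ((x 0, x 1), (x 2, x 3))) (Measure.pi fun _ => ν)
      ((ν.prod ν).prod (ν.prod ν)) := by
  refine ⟨by fun_prop, ?_⟩
  have hind := ProbabilityTheory.iIndepFun_pi (μ := fun _ : Fin 4 => ν) (X := fun _ => id)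
    (fun _ => aemeasurable_id)
  have h := (hind.indepFun_prodMk_prodMk (fun i => measurable_pi_apply i) 0 1 2 3 (by decide)
    (by decide) (by decide) (by decide)).map_prod_eq_prod_map_map (by fun_prop) (by fun_prop)
  simp only [id] at h
  rw [h, (measurePreserving_pi_pair ν (by decide : (0 : Fin 4) ≠ 1)).map_eq,
    (measurePreserving_pi_pair ν (by decide : (2 : Fin 4) ≠ 3)).map_eq]

end Modeling

/-- The signed 4-cycle integral is twice this pairing minus 1, so the value 1/2 would make it
vanish. -/
theorem Modeling.pairing_evenCycleFormula_ne (A : Modeling.{u} matroidLanguage) :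
    A.pairing evenCycleFormula ≠ 1 / 2 := by
  classical
  intro hA
  have hR : NullMeasurableSet {p : A.carrier × A.carrier | adjFormula.Realize ![p.1, p.2]}
      (A.ν.prod A.ν) :=
    (A.measurable_realize 2 adjFormula).preimage
      (measurePreserving_finTwoArrow A.ν).symm.quasiMeasurePreserving
  -- Adjacency is only null measurable. A measurable set equal to it almost everywhere gives a
  -- kernel that is measurable and still `±1` at every point.
  obtain ⟨S, -, hS, hSR⟩ := hR.exists_measurable_superset_ae_eq
  let H : A.carrier × A.carrier → ℝ := fun p => if p ∈ S then 1 else -1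
  have hH : Measurable H := Measurable.ite hS measurable_const measurable_const
  have hHadj : H =ᵐ[A.ν.prod A.ν] adjSign := by
    filter_upwards [hSR] with p hp
    have hp' : p ∈ S ↔ adjFormula.Realize ![p.1, p.2] := iff_of_eq hp
    simp only [H, adjSign, hp']
  refine integral_fourCycle_ne_zero A.ν hH (fun p => by by_cases h : p ∈ S <;> simp [H, h]) ?_
  have hT := measurePreserving_pi_pair_pair A.ν
  rw [← hT.map_eq, integral_map hT.measurable.aemeasurable
    (Measurable.aestronglyMeasurable (by fun_prop))]
  have hae : ∀ i j : Fin 4, i ≠ j → ∀ᵐ x ∂(Measure.pi fun _ : Fin 4 => A.ν),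
      H (x i, x j) = adjSign (x i, x j) := fun i j hij =>
    (measurePreserving_pi_pair A.ν hij).quasiMeasurePreserving.ae hHadj
  set P : Set (Fin 4 → A.carrier) := {x | evenCycleFormula.Realize x} with hP
  have hPm : NullMeasurableSet P (Measure.pi fun _ => A.ν) := A.measurable_realize 4 _
  have hint : Integrable (P.indicator (fun _ => (1 : ℝ))) (Measure.pi fun _ : Fin 4 => A.ν) :=
    (integrable_const (1 : ℝ)).indicator₀ hPm
  calc _ = ∫ x, (2 * P.indicator (fun _ => (1 : ℝ)) x - 1) ∂(Measure.pi fun _ => A.ν) := by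
        refine integral_congr_ae ?_
        filter_upwards [hae 0 2 (by decide), hae 1 2 (by decide), hae 0 3 (by decide),
          hae 1 3 (by decide)] with x h02 h12 h03 h13
        rw [h02, h12, h03, h13, adjSign_fourCycle]
        by_cases hx : evenCycleFormula.Realize x
        · have : x ∈ P := hx
          simp [hx, this]; norm_num
        · have : x ∉ P := hx
          simp [hx, this]
    _ = 2 * A.pairing evenCycleFormula - 1 := by
        rw [integral_sub (hint.const_mul 2) (integrable_const 1), integral_const_mul,
          integral_indicator₀ hPm]
        simp [Modeling.pairing, hP]
    _ = 0 := by rw [hA]; norm_num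

end FOMatroid

/-! ### The sequence without a limit modeling. -/

theorem theoremt :
    ∃ M : ℕ → Matroid ℕ,
      (∀ n, (M n).E.Finite ∧ (M n).E.Nonempty ∧ FOMatroid.IsBinary (M n)) ∧
      FOMatroid.FOConvergent M ∧
      ¬ ∃ A : FOMatroid.Modeling.{u} FOMatroid.matroidLanguage, FOMatroid.IsLimitModeling A M := by
  choose M hM hpair using FOMatroid.exists_quadric_matroid
  obtain ⟨s, hs, hconv⟩ := FOMatroid.exists_strictMono_foConvergent M fun n => (hM n).1
  refine ⟨M ∘ s, fun n => hM (s n), hconv, ?_⟩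
  rintro ⟨A, -, hA⟩
  refine A.pairing_evenCycleFormula_ne ?_
  have h0 : Filter.Tendsto
      (fun n => 2 * FOMatroid.finitePairing (M n) FOMatroid.evenCycleFormula - 1)
      Filter.atTop (nhds 0) := by
    refine squeeze_zero_norm hpair ?_
    simpa using (tendsto_pow_atTop_nhds_zero_of_lt_one (r := (1 / 4 : ℝ)) (by norm_num)
      (by norm_num)).const_mul 5
  have h1 := tendsto_nhds_unique (h0.comp hs.tendsto_atTop)
    (((hA 4 FOMatroid.evenCycleFormula).const_mul 2).sub_const 1)
  linarith
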